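/- Let $\mathcal H$ be a real Hilbert space, let $B\colon\mathcal H\to 2^{\mathcal H}$ be a set-valued operator and $D,C\colon\mathcal H\to\mathcal H$ be single-valued operators such that - $B$ is maximally monotone, - $D$ is $\delta$-Lipschitz continuous for some $\delta\ge 0$, - $B+D$ is maximally monotone, - $C$ is $\beta^{-1}$-cocoercive for some $\beta>0$, i.e. $\langle Cx-Cy,\,x-y\rangle\ge\beta^{-1}\|Cx-Cy\|^2$ for all $x,y\in\mathcal H$; if $C=0$, then $\beta=0$ is also allowed, - the inclusion $0\in Bx+Dx+Cx$ has at least one solution $x\in\mathcal H$. Let $(\alpha_k)_{k\ge 0}$ be a sequence of real numbers for which there exists $\epsilon>0$ such that $$\epsilon\le\alpha_k\quad\text{and}\quad \alpha_k\delta+\alpha_{k+1}\bigl(\delta+\tfrac{\beta}{2}\bigr)\le 1-\epsilon\qquad\text{for all }k\in\mathbb N=\{0,1,2,\dots\}.$$ Then for all $x_0,x_{-1}\in\mathcal H$ and $\alpha_{-1}>0$ the forward-half-reflected-backward iteration $$x_{k+1}=(\mathrm{Id}+\alpha_kB)^{-1}\bigl(x_k-\alpha_kCx_k-(\alpha_k+\alpha_{k-1})Dx_k+\alpha_{k-1}Dx_{k-1}\bigr),\qquad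 k\in\mathbb N,$$ determines a unique infinite sequence $(x_k)_{k\in\mathbb N}$, and $x_k$ converges weakly to some $x^\star\in\mathcal H$ with $0\in Bx^\star+Dx^\star+Cx^\star$. -/

import Mathlib

open Filter Topology
open scoped NNReal InnerProductSpace

namespace FHRB

variable {H : Type*} [NormedAddCommGroup H] [InnerProductSpace ℝ H]

/-- The graph `{(x, u) | u ∈ A x}` of a set-valued operator `A : H → 2^H`. -/
def gra (A : H → Set H) : Set (H × H) := {p | p.2 ∈ A p.1}

/-- A set-valued operator is monotone if `⟪u - v, x - y⟫ ≥ 0` for all `(x, u)` and `(y, v)` in its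
graph. -/
def IsMonotone (A : H → Set H) : Prop :=
  ∀ p ∈ gra A, ∀ q ∈ gra A, 0 ≤ ⟪p.2 - q.2, p.1 - q.1⟫_ℝ

/-- A monotone operator is maximally monotone if its graph is not a proper subset of the graph of
another monotone operator. -/
def IsMaximallyMonotone (A : H → Set H) : Prop :=
  IsMonotone A ∧ ∀ A' : H → Set H, IsMonotone A' → ¬ gra A ⊂ gra A'

/-- The sum `A + F` of a set-valued operator `A` and a single-valued operator `F`, that is,
`(A + F) x = {u + F x | u ∈ A x}`. -/
def opAdd (A : H → Set H) (F : H → H) : H → Set H := fun x => {w | ∃ u ∈ A x, w = u + F x}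

/-- The set of zeros of a set-valued operator. -/
def zer (A : H → Set H) : Set H := {x | 0 ∈ A x}

/-- For `ℓ > 0`, the operator `C` is `ℓ⁻¹`-cocoercive if
`⟪C x - C y, x - y⟫ ≥ ℓ⁻¹ ‖C x - C y‖ ^ 2` for all `x` and `y`. By convention `ℓ = 0` is also
allowed (exactly) for `C = 0`. -/
def IsInvCocoercive (ℓ : ℝ) (C : H → H) : Prop :=
  (0 < ℓ ∧ ∀ x y, ℓ⁻¹ * ‖C x - C y‖ ^ 2 ≤ ⟪C x - C y, x - y⟫_ℝ) ∨ (ℓ = 0 ∧ ∀ x, C x = 0)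

/-- The resolvent `(Id + a B)⁻¹`, as a set-valued operator: `p ∈ (Id + a B)⁻¹ z` if and only if
`z ∈ p + a B p`. -/
def resolvent (a : ℝ) (B : H → Set H) : H → Set H := fun z => {p | ∃ u ∈ B p, z = p + a • u}

/-- `x 0, x 1, x 2, …` is a sequence of forward-half-reflected-backward iterates with step sizes
`α 0, α 1, …`, started at `x 0 = x₀`, with additional initial data `x₋₁` (written `xm`) and `α₋₁`
(written `αm`). -/
structure IsIterates (B : H → Set H) (D C : H → H) (αm : ℝ) (α : ℕ → ℝ) (xm x₀ : H)
    (x : ℕ → H) : Prop where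
  init : x 0 = x₀
  first : x 1 ∈ resolvent (α 0) B
    (x 0 - α 0 • C (x 0) - (α 0 + αm) • D (x 0) + αm • D xm)
  step : ∀ k : ℕ, x (k + 2) ∈ resolvent (α (k + 1)) B
    (x (k + 1) - α (k + 1) • C (x (k + 1)) - (α (k + 1) + α k) • D (x (k + 1)) + α k • D (x k))

end FHRB

/-! Existence and uniqueness of the iterates come from single-valued, everywhere defined resolvents:
uniqueness is monotonicity, existence is Minty's theorem, proved by minimising the Fitzpatrick
function of the operator plus half the squared norm.

Convergence rests on the Lyapunov function of `lyapunov_step`. The iteration corrects `D` by the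
previous step's change, so monotonicity of `B + D` at the new point leaves two `D`-differences: one
telescopes, and the Lipschitz bound controls what remains of the other. With `C` costing β/4 per
squared step, the step-size condition leaves a decrease of at least ε times the squared step. Hence
steps and residuals tend to 0, and the correction terms vanish, so the distance to each solution
converges. Weak cluster points are solutions (`mem_zer_of_tendsto`), and Opial's lemma concludes. -/

namespace FHRB

/-! ### Minty's theorem and resolvents -/

section Minty

/-- A closed convex set lying above the paraboloid `t = -‖p‖ ^ 2 / 2` has a point minimising
`t + ‖p‖ ^ 2 / 2`; the conclusion is the first-order optimality condition at such a point. -/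
theorem exists_minimizer_add_half_sq_norm {E : Type*} [NormedAddCommGroup E]
    [InnerProductSpace ℝ E] [CompleteSpace E] {K : Set (E × ℝ)} (hne : K.Nonempty)
    (hcl : IsClosed K) (hcv : Convex ℝ K) (hb : ∀ z ∈ K, 0 ≤ z.2 + ‖z.1‖ ^ 2 / 2) :
    ∃ z ∈ K, ∀ w ∈ K, z.2 + ‖z.1‖ ^ 2 ≤ w.2 + ⟪z.1, w.1⟫_ℝ := by
  set φ : E × ℝ → ℝ := fun z => z.2 + ‖z.1‖ ^ 2 / 2 with hφ
  have hbdd : BddBelow (φ '' K) := ⟨0, by rintro _ ⟨z, hz, rfl⟩; exact hb z hz⟩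
  set m := sInf (φ '' K) with hm
  have hmle : ∀ z ∈ K, m ≤ φ z := fun z hz => csInf_le hbdd ⟨z, hz, rfl⟩
  have hseq : ∀ n : ℕ, ∃ z ∈ K, φ z < m + 1 / ((n : ℝ) + 1) := by
    intro n
    have hpos : 0 < 1 / ((n : ℝ) + 1) := by positivity
    obtain ⟨_, ⟨z, hz, rfl⟩, h⟩ :=
      exists_lt_of_csInf_lt (hne.image φ) (lt_add_of_pos_right m hpos)
    exact ⟨z, hz, h⟩
  choose z hzK hz using hseq
  -- Parallelogram identity at the midpoint, which lies in `K`: the first components of a minimising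
  -- sequence are Cauchy. The second components then converge because `φ` does.
  have hpar : ∀ a ∈ K, ∀ b ∈ K, ‖a.1 - b.1‖ ^ 2 ≤ 4 * (φ a - m) + 4 * (φ b - m) := by
    intro a ha b hb
    have hmid := hmle _ (hcv ha hb (by norm_num : (0 : ℝ) ≤ 1 / 2)
      (by norm_num : (0 : ℝ) ≤ 1 / 2) (by norm_num))
    have h1 : ‖(1 / 2 : ℝ) • a.1 + (1 / 2 : ℝ) • b.1‖ ^ 2
        = ‖a.1‖ ^ 2 / 2 + ‖b.1‖ ^ 2 / 2 - ‖a.1 - b.1‖ ^ 2 / 4 := by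
      rw [norm_add_sq_real, norm_sub_sq_real, norm_smul, norm_smul, inner_smul_left,
        inner_smul_right]
      norm_num
      ring
    simp only [hφ, Prod.fst_add, Prod.snd_add, Prod.smul_fst, Prod.smul_snd, smul_eq_mul, h1]
      at hmid ⊢
    linarith
  have hφt : Tendsto (fun n => φ (z n)) atTop (𝓝 m) := by
    have h := (tendsto_one_div_add_atTop_nhds_zero_nat (𝕜 := ℝ)).const_add m
    rw [add_zero] at h
    exact tendsto_of_tendsto_of_tendsto_of_le_of_le tendsto_const_nhds h
      (fun n => hmle _ (hzK n)) (fun n => (hz n).le)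
  have hcau : CauchySeq fun n => (z n).1 := by
    refine cauchySeq_of_le_tendsto_0 (fun N : ℕ => √(8 * (1 / ((N : ℝ) + 1)))) ?_ ?_
    · intro n k N hn hk
      rw [dist_eq_norm]
      refine Real.le_sqrt_of_sq_le ?_
      have h := hpar _ (hzK n) _ (hzK k)
      have h1 := Nat.one_div_le_one_div (α := ℝ) hn
      have h2 := Nat.one_div_le_one_div (α := ℝ) hk
      linarith [hz n, hz k]
    · have h := ((tendsto_one_div_add_atTop_nhds_zero_nat (𝕜 := ℝ)).const_mul 8).sqrt
      simpa using h
  obtain ⟨p, hp⟩ := cauchySeq_tendsto_of_complete hcau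
  have ht : Tendsto (fun n => (z n).2) atTop (𝓝 (m - ‖p‖ ^ 2 / 2)) := by
    have h := hφt.sub ((hp.norm.pow 2).div_const 2)
    refine h.congr fun n => ?_
    simp [hφ]
  have hmem : (p, m - ‖p‖ ^ 2 / 2) ∈ K :=
    hcl.mem_of_tendsto (hp.prodMk_nhds ht) (Eventually.of_forall hzK)
  refine ⟨_, hmem, fun w hw => ?_⟩
  -- Minimality against the point at parameter `l` of the segment towards `w`, divided by `l`; then
  -- `l → 0`.
  have hkey : ∀ l : ℝ, 0 < l → l < 1 →
      m - ‖p‖ ^ 2 / 2 - ⟪p, w.1 - p⟫_ℝ - w.2 ≤ l * (‖w.1 - p‖ ^ 2 / 2) := by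
    intro l hl hl1
    have h := hmle _ (hcv hmem hw (sub_nonneg.2 hl1.le) hl.le (by ring))
    have h1 : ‖(1 - l) • p + l • w.1‖ ^ 2
        = ‖p‖ ^ 2 + 2 * l * ⟪p, w.1 - p⟫_ℝ + l ^ 2 * ‖w.1 - p‖ ^ 2 := by
      rw [show (1 - l) • p + l • w.1 = p + l • (w.1 - p) by module, norm_add_sq_real,
        inner_smul_right, norm_smul, mul_pow, Real.norm_eq_abs, sq_abs]
      ring
    simp only [hφ, Prod.fst_add, Prod.snd_add, Prod.smul_fst, Prod.smul_snd, smul_eq_mul, h1]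
      at h
    refine le_of_mul_le_mul_left ?_ hl
    linarith
  have hlim : m - ‖p‖ ^ 2 / 2 - ⟪p, w.1 - p⟫_ℝ - w.2 ≤ 0 := by
    have h : Tendsto (fun l : ℝ => l * (‖w.1 - p‖ ^ 2 / 2)) (𝓝[>] 0) (𝓝 0) := by
      have h := (tendsto_id (α := ℝ) (x := 𝓝 0)).mul_const (‖w.1 - p‖ ^ 2 / 2)
      rw [zero_mul] at h
      exact h.mono_left nhdsWithin_le_nhds
    refine ge_of_tendsto h ?_
    filter_upwards [Ioo_mem_nhdsGT (zero_lt_one' ℝ)] with l hl using hkey l hl.1 hl.2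
  rw [inner_sub_right, real_inner_self_eq_norm_sq] at hlim
  simp only
  linarith

variable {H : Type*} [NormedAddCommGroup H] [InnerProductSpace ℝ H]

/-- A point that is monotonically related to the graph of a maximally monotone operator belongs
to that graph. -/
theorem IsMaximallyMonotone.mem_of_forall {A : H → Set H} (hA : IsMaximallyMonotone A) {x u : H}
    (h : ∀ y, ∀ v ∈ A y, 0 ≤ ⟪v - u, y - x⟫_ℝ) : u ∈ A x := by
  by_contra hxu
  refine hA.2 (fun y => {v | v ∈ A y ∨ (y = x ∧ v = u)}) ?_ ⟨fun p hp => Or.inl hp, fun hsub =>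
    hxu (hsub (show ((x, u) : H × H) ∈ gra _ from Or.inr ⟨rfl, rfl⟩))⟩
  rintro ⟨y, v⟩ (hv | ⟨hy, hv⟩) ⟨z, w⟩ (hw | ⟨hz, hw⟩)
  · exact hA.1 (y, v) hv (z, w) hw
  · simp only at hz hw
    subst hz hw
    exact h y v hv
  · simp only at hy hv
    subst hy hv
    rw [← inner_neg_neg, neg_sub, neg_sub]
    exact h z w hw
  · simp only at hy hv hz hw
    simp [hy, hv, hz, hw]

/-- **Minty's theorem**: if `A` is maximally monotone, then `0` is in the range of `Id + A`. -/
theorem IsMaximallyMonotone.exists_neg_mem [CompleteSpace H] {A : H → Set H}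
    (hA : IsMaximallyMonotone A) : ∃ x, -x ∈ A x := by
  -- `K` is the epigraph of the Fitzpatrick function of `A`; the `L²` product norm makes `H × H` a
  -- Hilbert space.
  set K : Set (WithLp 2 (H × H) × ℝ) :=
    {z | ∀ q ∈ gra A, ⟪q.1, z.1.snd⟫_ℝ + ⟪q.2, z.1.fst⟫_ℝ - ⟪q.1, q.2⟫_ℝ ≤ z.2} with hK
  have hnorm : ∀ p : WithLp 2 (H × H), ‖p‖ ^ 2 = ‖p.fst‖ ^ 2 + ‖p.snd‖ ^ 2 :=
    fun p => WithLp.prod_norm_sq_eq_of_L2 p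
  have hmem : ∀ q ∈ gra A, (WithLp.toLp 2 q, ⟪q.1, q.2⟫_ℝ) ∈ K := by
    intro q hq r hr
    have h := hA.1 q hq r hr
    simp only [inner_sub_left, inner_sub_right] at h
    simp only [WithLp.toLp_fst, WithLp.toLp_snd]
    linarith [real_inner_comm q.1 q.2, real_inner_comm r.1 r.2, real_inner_comm r.1 q.2]
  -- If this failed, `z.1` would be monotonically related to the graph, hence in it, and testing `K`
  -- at `z.1` itself would give a contradiction.
  have hge : ∀ z ∈ K, ⟪z.1.fst, z.1.snd⟫_ℝ ≤ z.2 := by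
    intro z hz
    by_contra! hlt
    have hin : z.1.snd ∈ A z.1.fst := by
      refine hA.mem_of_forall fun y v hv => ?_
      have h := hz (y, v) hv
      simp only [inner_sub_left, inner_sub_right] at h ⊢
      linarith [real_inner_comm y v, real_inner_comm z.1.fst z.1.snd, real_inner_comm y z.1.snd]
    have h := hz (z.1.fst, z.1.snd) hin
    simp only at h
    linarith [real_inner_comm z.1.fst z.1.snd]
  have hne : K.Nonempty := by
    by_cases hG : (gra A).Nonempty
    · obtain ⟨q, hq⟩ := hG
      exact ⟨_, hmem q hq⟩
    · exact ⟨0, fun q hq => (hG ⟨q, hq⟩).elim⟩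
  have hcl : IsClosed K := by
    simp only [hK, Set.ofPred_forall]
    refine isClosed_biInter fun q _ => isClosed_le ?_ continuous_snd
    fun_prop
  have hcv : Convex ℝ K := by
    intro a ha b hb s t hs ht hst q hq
    have h1 := mul_le_mul_of_nonneg_left (ha q hq) hs
    have h2 := mul_le_mul_of_nonneg_left (hb q hq) ht
    simp only [Prod.fst_add, Prod.snd_add, Prod.smul_fst, Prod.smul_snd, smul_eq_mul,
      WithLp.add_fst, WithLp.add_snd, WithLp.smul_fst, WithLp.smul_snd, inner_add_right,
      inner_smul_right]
    obtain rfl : t = 1 - s := by linarith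
    linarith
  obtain ⟨z, hz, hmin⟩ := exists_minimizer_add_half_sq_norm hne hcl hcv fun z hz => by
    rw [hnorm]
    have h := norm_add_sq_real z.1.fst z.1.snd
    linarith [hge z hz, sq_nonneg ‖z.1.fst + z.1.snd‖]
  -- Optimality tested at graph points, lifted to `K` by `hmem`. It puts `(-z.1.snd, -z.1.fst)` in
  -- the graph; reinserting that point forces `z.1.fst + z.1.snd = 0`.
  have hopt : ∀ y, ∀ v ∈ A y,
      ‖z.1.fst + z.1.snd‖ ^ 2 ≤ ⟪v - -z.1.fst, y - -z.1.snd⟫_ℝ := by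
    intro y v hv
    have h := hmin _ (hmem (y, v) hv)
    have h' := hge z hz
    rw [hnorm, WithLp.prod_inner_apply] at h
    rw [norm_add_sq_real]
    simp only [sub_neg_eq_add, inner_add_left, inner_add_right]
    change _ ≤ _ + (⟪z.1.fst, y⟫_ℝ + ⟪z.1.snd, v⟫_ℝ) at h
    linarith [real_inner_comm y v, real_inner_comm v z.1.snd]
  have hin : -z.1.fst ∈ A (-z.1.snd) :=
    hA.mem_of_forall fun y v hv => (sq_nonneg _).trans (hopt y v hv)
  have h0 := hopt _ _ hin
  simp only [sub_self, inner_zero_left] at h0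
  have hsum : z.1.fst + z.1.snd = 0 :=
    norm_eq_zero.1 (pow_eq_zero_iff two_ne_zero |>.1 (le_antisymm h0 (sq_nonneg _)))
  have hs : -z.1.snd = z.1.fst := (eq_neg_of_add_eq_zero_left hsum).symm
  exact ⟨z.1.fst, by rwa [hs] at hin⟩

theorem IsMaximallyMonotone.exists_mem_resolvent [CompleteSpace H] {B : H → Set H}
    (hB : IsMaximallyMonotone B) {a : ℝ} (ha : 0 < a) (z : H) : ∃ p, p ∈ resolvent a B z := by
  -- `A = a B - z`, so `-x ∈ A x` says exactly that `z ∈ x + a B x`.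
  set A : H → Set H := fun x => {w | a⁻¹ • (w + z) ∈ B x} with hAdef
  have hinner : ∀ v w y x : H,
      ⟪v - w, y - x⟫_ℝ = a * ⟪a⁻¹ • (v + z) - a⁻¹ • (w + z), y - x⟫_ℝ := by
    intro v w y x
    rw [← smul_sub, inner_smul_left, add_sub_add_right_eq_sub]
    simp [ha.ne']
  have hA : IsMaximallyMonotone A := by
    refine ⟨fun p hp q hq => ?_, fun A' hA' hss => ?_⟩
    · rw [hinner]
      exact mul_nonneg ha.le (hB.1 (p.1, a⁻¹ • (p.2 + z)) hp (q.1, a⁻¹ • (q.2 + z)) hq)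
    · refine hss.2 fun p hp => hB.mem_of_forall fun y v hv => ?_
      have hv' : (y, a • v - z) ∈ gra A := by
        change a⁻¹ • (a • v - z + z) ∈ B y
        rwa [sub_add_cancel, inv_smul_smul₀ ha.ne']
      have h := hA' _ (hss.1 hv') p hp
      rw [hinner] at h
      have h := nonneg_of_mul_nonneg_right h ha
      simpa [smul_smul, ha.ne'] using h
  obtain ⟨x, hx⟩ := hA.exists_neg_mem
  refine ⟨x, a⁻¹ • (-x + z), hx, ?_⟩
  rw [smul_smul, mul_inv_cancel₀ ha.ne', one_smul]
  abel

theorem IsMonotone.eq_of_mem_resolvent {B : H → Set H} (hB : IsMonotone B) {a : ℝ} (ha : 0 < a)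
    {z p q : H} (hp : p ∈ resolvent a B z) (hq : q ∈ resolvent a B z) : p = q := by
  obtain ⟨u, hu, hpu⟩ := hp
  obtain ⟨v, hv, hqv⟩ := hq
  have h := mul_nonneg ha.le (hB (p, u) hu (q, v) hv)
  have he : a • (u - v) = -(p - q) := by
    have : p + a • u = q + a • v := hpu.symm.trans hqv
    rw [smul_sub, eq_sub_of_add_eq' this]
    abel
  rw [← real_inner_smul_left, he, inner_neg_left, real_inner_self_eq_norm_sq] at h
  exact sub_eq_zero.1 (norm_eq_zero.1 (pow_eq_zero_iff two_ne_zero |>.1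
    (le_antisymm (by linarith) (sq_nonneg _))))

end Minty

/-! ### Existence and uniqueness of the iterates -/

section Iterates

variable {H : Type*} [NormedAddCommGroup H] [InnerProductSpace ℝ H]

theorem existsUnique_isIterates [CompleteSpace H] {B : H → Set H} (hB : IsMaximallyMonotone B)
    (D C : H → H) (αm : ℝ) {α : ℕ → ℝ} (hα : ∀ k, 0 < α k) (xm x₀ : H) :
    ∃! x : ℕ → H, IsIterates B D C αm α xm x₀ x := by
  choose J hJ using fun (k : ℕ) (z : H) => hB.exists_mem_resolvent (hα k) z
  -- The recursion is of second order, so the state is the pair of consecutive iterates.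
  let s : ℕ → H × H := Nat.rec
    (x₀, J 0 (x₀ - α 0 • C x₀ - (α 0 + αm) • D x₀ + αm • D xm))
    (fun k p => (p.2, J (k + 1)
      (p.2 - α (k + 1) • C p.2 - (α (k + 1) + α k) • D p.2 + α k • D p.1)))
  refine ⟨fun k => (s k).1, ⟨rfl, hJ _ _, fun k => hJ _ _⟩, fun y hy => ?_⟩
  have hx : IsIterates B D C αm α xm x₀ fun k => (s k).1 := ⟨rfl, hJ _ _, fun k => hJ _ _⟩
  have hpair : ∀ k, y k = (s k).1 ∧ y (k + 1) = (s (k + 1)).1 := by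
    intro k
    induction k with
    | zero =>
      have h0 : y 0 = (s 0).1 := hy.init
      refine ⟨h0, hB.1.eq_of_mem_resolvent (hα 0) hy.first ?_⟩
      rw [h0]
      exact hx.first
    | succ k ih =>
      refine ⟨ih.2, hB.1.eq_of_mem_resolvent (hα (k + 1)) (hy.step k) ?_⟩
      rw [ih.1, ih.2]
      exact hx.step k
  exact funext fun k => (hpair k).1

end Iterates

/-! ### Weak limits and Opial's lemma -/

section WeakLimits

variable {H : Type*} [NormedAddCommGroup H] [InnerProductSpace ℝ H] {ι : Type*}

theorem tendsto_toWeakSpace_of_inner [CompleteSpace H] {l : Filter ι} {x : ι → H} {a : H}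
    (h : ∀ v, Tendsto (fun i => ⟪v, x i⟫_ℝ) l (𝓝 ⟪v, a⟫_ℝ)) :
    Tendsto (fun i => toWeakSpace ℝ H (x i)) l (𝓝 (toWeakSpace ℝ H a)) := by
  have hinj : Function.Injective (topDualPairing ℝ H).flip := by
    intro y z hyz
    refine ext_inner_left ℝ fun v => ?_
    exact DFunLike.congr_fun hyz (InnerProductSpace.toDual ℝ H v)
  refine (WeakBilin.tendsto_iff_forall_eval_tendsto _ hinj).2 fun f => ?_
  obtain ⟨v, rfl⟩ := (InnerProductSpace.toDual ℝ H).surjective f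
  exact h v

/-- Bounded families in a Hilbert space converge weakly along ultrafilters. -/
theorem exists_tendsto_inner_ultrafilter [CompleteSpace H] (U : Ultrafilter ι) {x : ι → H} {r : ℝ}
    (hx : ∀ i, ‖x i‖ ≤ r) : ∃ a, ∀ v, Tendsto (fun i => ⟪v, x i⟫_ℝ) U (𝓝 ⟪v, a⟫_ℝ) := by
  set f : ι → WeakDual ℝ H := fun i =>
    StrongDual.toWeakDual (InnerProductSpace.toDual ℝ H (x i)) with hf
  have hc := WeakDual.isCompact_closedBall (𝕜 := ℝ) (E := H) 0 r
  obtain ⟨g, -, hg⟩ := hc.ultrafilter_le_nhds (U.map f) (by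
    rw [le_principal_iff]
    refine mem_map.2 (univ_mem' fun i => ?_)
    simpa [hf] using hx i)
  refine ⟨(InnerProductSpace.toDual ℝ H).symm (WeakDual.toStrongDual g), fun v => ?_⟩
  have h := ((WeakDual.eval_continuous v).tendsto g).comp (show Tendsto f U (𝓝 g) from hg)
  rw [real_inner_comm, InnerProductSpace.toDual_symm_apply]
  refine h.congr fun i => ?_
  exact real_inner_comm _ _

/-- The inner product of a weakly convergent bounded family and a strongly convergent one. -/
theorem tendsto_inner_of_weak {l : Filter ι} {x w : ι → H} {a b : H} {r : ℝ}
    (hr : ∀ i, ‖x i‖ ≤ r) (hx : ∀ v, Tendsto (fun i => ⟪v, x i⟫_ℝ) l (𝓝 ⟪v, a⟫_ℝ))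
    (hw : Tendsto w l (𝓝 b)) : Tendsto (fun i => ⟪w i, x i⟫_ℝ) l (𝓝 ⟪b, a⟫_ℝ) := by
  have h0 : Tendsto (fun i => ⟪w i - b, x i⟫_ℝ) l (𝓝 0) := by
    have h1 : Tendsto (fun i => ‖w i - b‖ * r) l (𝓝 0) := by
      simpa using (tendsto_iff_norm_sub_tendsto_zero.1 hw).mul_const r
    refine squeeze_zero_norm (fun i => ?_) h1
    exact (norm_inner_le_norm _ _).trans (mul_le_mul_of_nonneg_left (hr i) (norm_nonneg _))
  have h := h0.add (hx b)
  rw [zero_add] at h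
  refine h.congr fun i => ?_
  rw [inner_sub_left]
  ring

/-- The graph of a maximally monotone operator is closed under weak-strong limits. -/
theorem IsMaximallyMonotone.mem_of_tendsto {A : H → Set H} (hA : IsMaximallyMonotone A)
    {l : Filter ι} [l.NeBot] {x w : ι → H} {a b : H} {r : ℝ} (hr : ∀ i, ‖x i‖ ≤ r)
    (hx : ∀ v, Tendsto (fun i => ⟪v, x i⟫_ℝ) l (𝓝 ⟪v, a⟫_ℝ)) (hw : Tendsto w l (𝓝 b))
    (hmem : ∀ i, w i ∈ A (x i)) : b ∈ A a := by
  refine hA.mem_of_forall fun y v hv => ?_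
  have h1 := tendsto_inner_of_weak hr hx (hw.const_sub v)
  have h2 : Tendsto (fun i => ⟪v - w i, y⟫_ℝ) l (𝓝 ⟪v - b, y⟫_ℝ) :=
    (hw.const_sub v).inner tendsto_const_nhds
  have h := h2.sub h1
  simp only [← inner_sub_right] at h
  exact ge_of_tendsto' h fun i => hA.1 (y, v) hv (x i, w i) (hmem i)

/-- **Opial's lemma**: a sequence whose distances to all points of `S` converge, and whose weak
limits along ultrafilters belong to `S`, converges weakly to a point of `S`. -/
theorem exists_tendsto_toWeakSpace_of_opial [CompleteSpace H] {S : Set H} {x : ℕ → H} {r : ℝ}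
    (hr : ∀ k, ‖x k‖ ≤ r)
    (hdist : ∀ a ∈ S, ∃ c : ℝ, Tendsto (fun k => ‖x k - a‖ ^ 2) atTop (𝓝 c))
    (hlim : ∀ U : Ultrafilter ℕ, (U : Filter ℕ) ≤ atTop → ∀ a,
      (∀ v, Tendsto (fun k => ⟪v, x k⟫_ℝ) U (𝓝 ⟪v, a⟫_ℝ)) → a ∈ S) :
    ∃ a ∈ S, Tendsto (fun k => toWeakSpace ℝ H (x k)) atTop (𝓝 (toWeakSpace ℝ H a)) := by
  obtain ⟨a, ha⟩ := exists_tendsto_inner_ultrafilter (Ultrafilter.of atTop) hr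
  have haS := hlim _ (Ultrafilter.of_le atTop) a ha
  refine ⟨a, haS, tendsto_toWeakSpace_of_inner fun v => ?_⟩
  rw [tendsto_iff_ultrafilter]
  intro U hU
  obtain ⟨b, hb⟩ := exists_tendsto_inner_ultrafilter U hr
  have hbS := hlim U hU b hb
  obtain ⟨c, hc⟩ := hdist a haS
  obtain ⟨d, hd⟩ := hdist b hbS
  -- `‖x k - a‖ ^ 2 - ‖x k - b‖ ^ 2` is affine in `⟪b - a, x k⟫`, which therefore has one limit, the
  -- same along both ultrafilters.
  have hdiff : Tendsto (fun k => ⟪b - a, x k⟫_ℝ) atTop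
      (𝓝 ((c - d - ‖a‖ ^ 2 + ‖b‖ ^ 2) / 2)) := by
    refine ((((hc.sub hd).sub_const (‖a‖ ^ 2)).add_const (‖b‖ ^ 2)).div_const 2).congr
      fun k => ?_
    rw [norm_sub_sq_real, norm_sub_sq_real, inner_sub_left, real_inner_comm a, real_inner_comm b]
    ring
  have h1 := tendsto_nhds_unique (ha (b - a)) (hdiff.mono_left (Ultrafilter.of_le atTop))
  have h2 := tendsto_nhds_unique (hb (b - a)) (hdiff.mono_left hU)
  have h3 : ⟪b - a, b - a⟫_ℝ = 0 := by
    rw [inner_sub_right, h1, h2, sub_self]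
  rw [inner_self_eq_zero, sub_eq_zero] at h3
  exact h3 ▸ hb v

end WeakLimits

/-! ### Lyapunov descent and weak convergence -/

section Convergence

variable {H : Type*} [NormedAddCommGroup H] [InnerProductSpace ℝ H]

theorem IsInvCocoercive.nonneg {β : ℝ} {C : H → H} (hC : IsInvCocoercive β C) : 0 ≤ β := by
  rcases hC with h | h
  · exact h.1.le
  · exact h.1.ge

theorem IsInvCocoercive.sq_norm_sub_le {β : ℝ} {C : H → H} (hC : IsInvCocoercive β C) (x y : H) :
    ‖C x - C y‖ ^ 2 ≤ β * ⟪C x - C y, x - y⟫_ℝ := by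
  rcases hC with ⟨hβ, h⟩ | ⟨rfl, h⟩
  · have := mul_le_mul_of_nonneg_left (h x y) hβ.le
    rwa [mul_inv_cancel_left₀ hβ.ne'] at this
  · simp [h]

theorem IsInvCocoercive.norm_sub_le {β : ℝ} {C : H → H} (hC : IsInvCocoercive β C) (x y : H) :
    ‖C x - C y‖ ≤ β * ‖x - y‖ := by
  rcases (norm_nonneg (C x - C y)).eq_or_lt with h0 | h0
  · rw [← h0]
    exact mul_nonneg hC.nonneg (norm_nonneg _)
  · have h := (hC.sq_norm_sub_le x y).trans
      (mul_le_mul_of_nonneg_left (real_inner_le_norm _ _) hC.nonneg)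
    refine le_of_mul_le_mul_left ?_ h0
    linarith

/-- The forward step of a cocoercive operator costs at most a quarter of its constant times the
squared length of the step. -/
theorem IsInvCocoercive.neg_inner_le {β : ℝ} {C : H → H} (hC : IsInvCocoercive β C) (x y z : H) :
    -⟪C x - C z, y - z⟫_ℝ ≤ β / 4 * ‖y - x‖ ^ 2 := by
  rcases hC.nonneg.eq_or_lt with h0 | h0
  · have h : ‖C x - C z‖ ≤ 0 := by simpa [← h0] using hC.norm_sub_le x z
    simp [norm_le_zero_iff.1 h, ← h0]
  · have h1 := hC.sq_norm_sub_le x z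
    -- Completing this square cancels the `‖C x - C z‖ ^ 2` supplied by cocoercivity and leaves the
    -- constant β/4.
    have h2 := sq_nonneg ‖C x - C z + (β / 2) • (y - x)‖
    rw [norm_add_sq_real, inner_smul_right, norm_smul, mul_pow, Real.norm_eq_abs, sq_abs] at h2
    have h3 : ⟪C x - C z, y - z⟫_ℝ = ⟪C x - C z, x - z⟫_ℝ + ⟪C x - C z, y - x⟫_ℝ := by
      rw [← inner_add_right]
      congr 1
      abel
    refine le_of_mul_le_mul_left ?_ h0
    rw [h3]
    linarith

/-- If `xs` is a zero of `A + C`, residuals of `A + C` at a bounded sequence tend to `0` and the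
sequence converges weakly, then its limit is a zero of `A + C`. -/
theorem mem_zer_of_tendsto {A : H → Set H} (hA : IsMaximallyMonotone A) {β : ℝ} {C : H → H}
    (hC : IsInvCocoercive β C) {xs : H} (hxs : xs ∈ zer (opAdd A C)) {ι : Type*} {l : Filter ι}
    [l.NeBot] {x w : ι → H} {a : H} {r : ℝ} (hr : ∀ i, ‖x i‖ ≤ r)
    (hx : ∀ v, Tendsto (fun i => ⟪v, x i⟫_ℝ) l (𝓝 ⟪v, a⟫_ℝ)) (hw : Tendsto w l (𝓝 0))
    (hmem : ∀ i, w i ∈ opAdd A C (x i)) : a ∈ zer (opAdd A C) := by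
  obtain ⟨us, hus, hus0⟩ := hxs
  choose u hu hwu using hmem
  -- Cocoercivity turns vanishing upper bounds on the inner products into strong convergence of `C
  -- (x i)`. Used at `xs`, where monotonicity of `A` gives the bound, then at `a`, it yields the
  -- limit `C a`, so only the graph of `A` needs to be closed.
  have hstrong : ∀ (y : H) (g : ι → ℝ), Tendsto g l (𝓝 0) →
      (∀ i, ⟪C (x i) - C y, x i - y⟫_ℝ ≤ g i) → Tendsto (fun i => C (x i)) l (𝓝 (C y)) := by
    intro y g hg hle
    have hsq : Tendsto (fun i => ‖C (x i) - C y‖ ^ 2) l (𝓝 0) := by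
      refine squeeze_zero (fun i => sq_nonneg _) (fun i => (hC.sq_norm_sub_le (x i) y).trans
        (mul_le_mul_of_nonneg_left (hle i) hC.nonneg)) ?_
      simpa using hg.const_mul β
    rw [tendsto_iff_norm_sub_tendsto_zero]
    simpa using hsq.sqrt
  have hCs : Tendsto (fun i => C (x i)) l (𝓝 (C xs)) := by
    refine hstrong xs (fun i => ⟪w i, x i - xs⟫_ℝ) ?_ fun i => ?_
    · have h := (tendsto_inner_of_weak hr hx hw).sub (hw.inner (tendsto_const_nhds (x := xs)))
      simpa [← inner_sub_right] using h
    · have h := hA.1 (x i, u i) (hu i) (xs, us) hus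
      simp only at h ⊢
      have he : w i = (u i - us) + (C (x i) - C xs) := by
        rw [hwu i, eq_neg_of_add_eq_zero_left hus0.symm]
        abel
      rw [he, inner_add_left]
      linarith
  have hCa : Tendsto (fun i => C (x i)) l (𝓝 (C a)) := by
    refine hstrong a _ ?_ fun i => le_rfl
    have h := (tendsto_inner_of_weak hr hx (hCs.sub_const (C a))).sub
      ((hCs.sub_const (C a)).inner (tendsto_const_nhds (x := a)))
    simpa [← inner_sub_right] using h
  refine ⟨0 - C a, hA.mem_of_tendsto hr hx (hw.sub hCa) fun i => ?_, by simp⟩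
  rw [hwu i, add_sub_cancel_right]
  exact hu i

/-- A nonnegative sequence that decreases by at least `b k` in step `k` converges, and `b` tends to
`0`. -/
theorem tendsto_of_le_sub {V b : ℕ → ℝ} (hV : ∀ k, 0 ≤ V k) (hb : ∀ k, 0 ≤ b k)
    (h : ∀ k, V (k + 1) ≤ V k - b k) :
    (∃ c, Tendsto V atTop (𝓝 c)) ∧ Tendsto b atTop (𝓝 0) := by
  have hanti : Antitone V := antitone_nat_of_succ_le fun k => by linarith [h k, hb k]
  have hc := tendsto_atTop_ciInf hanti ⟨0, by rintro _ ⟨k, rfl⟩; exact hV k⟩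
  refine ⟨⟨_, hc⟩, squeeze_zero hb (fun k => le_sub_comm.1 (h k)) ?_⟩
  simpa using hc.sub (hc.comp (tendsto_add_atTop_nat 1))

/-- One step of the iteration decreases the Lyapunov function
`‖x - xs‖ ^ 2 - 2 ⟪a • (D x - D x'), x - xs⟫ + a δ ‖x - x'‖ ^ 2`. -/
theorem lyapunov_step {B : H → Set H} {D C : H → H} {δ : ℝ≥0} {β : ℝ} (hD : LipschitzWith δ D)
    (hBD : IsMonotone (opAdd B D)) (hC : IsInvCocoercive β C) {xs : H}
    (hxs : xs ∈ zer (opAdd (opAdd B D) C)) {a b : ℝ} (ha : 0 ≤ a) (hb : 0 ≤ b) {x y z : H}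
    (hz : z ∈ resolvent b B (y - b • C y - (b + a) • D y + a • D x)) :
    ‖z - xs‖ ^ 2 - 2 * ⟪b • (D z - D y), z - xs⟫_ℝ + b * δ * ‖z - y‖ ^ 2 ≤
      ‖y - xs‖ ^ 2 - 2 * ⟪a • (D y - D x), y - xs⟫_ℝ + a * δ * ‖y - x‖ ^ 2
        - (1 - (a * δ + b * (δ + β / 2))) * ‖z - y‖ ^ 2 := by
  obtain ⟨u, hu, hzu⟩ := hz
  obtain ⟨us, hus, hus0⟩ := hxs
  have hmon := mul_nonneg hb (hBD (z, u + D z) ⟨u, hu, rfl⟩ (xs, us) hus)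
  have he : b • (u + D z - us)
      = (y - z) + b • (D z - D y) - a • (D y - D x) - b • (C y - C xs) := by
    have h1 : us = -C xs := eq_neg_of_add_eq_zero_left hus0.symm
    have h2 : b • u = y - b • C y - (b + a) • D y + a • D x - z := eq_sub_of_add_eq' hzu.symm
    rw [smul_sub, smul_add, h2, h1]
    module
  simp only at hmon
  rw [← real_inner_smul_left, he, inner_sub_left, inner_sub_left, inner_add_left,
    real_inner_smul_left (C y - C xs)] at hmon
  have h1 : 2 * ⟪y - z, z - xs⟫_ℝ = ‖y - xs‖ ^ 2 - ‖z - xs‖ ^ 2 - ‖z - y‖ ^ 2 := by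
    have h := norm_add_sq_real (y - z) (z - xs)
    rw [sub_add_sub_cancel, norm_sub_rev y z] at h
    linarith
  have h2 := mul_le_mul_of_nonneg_left (hC.neg_inner_le y z xs) hb
  have h3 : ⟪a • (D y - D x), z - xs⟫_ℝ
      = ⟪a • (D y - D x), y - xs⟫_ℝ + ⟪a • (D y - D x), z - y⟫_ℝ := by
    rw [← inner_add_right]
    congr 1
    abel
  -- Young's inequality: the `‖y - x‖` half is absorbed by the old Lyapunov term, the `‖z - y‖` half
  -- is charged to the decrease.
  have h4 : -⟪a • (D y - D x), z - y⟫_ℝ ≤ a * δ * (‖y - x‖ ^ 2 + ‖z - y‖ ^ 2) / 2 := by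
    have h5 := (abs_le.1 (abs_real_inner_le_norm (a • (D y - D x)) (z - y))).1
    have h6 : ‖a • (D y - D x)‖ ≤ a * (δ * ‖y - x‖) := by
      rw [norm_smul, Real.norm_of_nonneg ha]
      exact mul_le_mul_of_nonneg_left (hD.norm_sub_le y x) ha
    have h7 := mul_le_mul_of_nonneg_right h6 (norm_nonneg (z - y))
    have h8 := mul_nonneg (mul_nonneg ha δ.coe_nonneg) (sq_nonneg (‖y - x‖ - ‖z - y‖))
    linarith
  linarith

/-- The Lyapunov function dominates the squared distance to the solution. -/
theorem lyapunov_ge {D : H → H} {δ : ℝ≥0} (hD : LipschitzWith δ D) {a : ℝ} (ha : 0 ≤ a)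
    (x y xs : H) :
    (1 - a * δ) * ‖y - xs‖ ^ 2 ≤
      ‖y - xs‖ ^ 2 - 2 * ⟪a • (D y - D x), y - xs⟫_ℝ + a * δ * ‖y - x‖ ^ 2 := by
  have h5 := real_inner_le_norm (a • (D y - D x)) (y - xs)
  have h6 : ‖a • (D y - D x)‖ ≤ a * (δ * ‖y - x‖) := by
    rw [norm_smul, Real.norm_of_nonneg ha]
    exact mul_le_mul_of_nonneg_left (hD.norm_sub_le y x) ha
  have h7 := mul_le_mul_of_nonneg_right h6 (norm_nonneg (y - xs))
  have h8 := mul_nonneg (mul_nonneg ha δ.coe_nonneg) (sq_nonneg (‖y - x‖ - ‖y - xs‖))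
  linarith

theorem exists_tendsto_of_isIterates [CompleteSpace H] {B : H → Set H} {D C : H → H} {δ : ℝ≥0}
    {β : ℝ} (hD : LipschitzWith δ D) (hBD : IsMaximallyMonotone (opAdd B D))
    (hC : IsInvCocoercive β C) (hzer : (zer (opAdd (opAdd B D) C)).Nonempty) {αm : ℝ}
    {α : ℕ → ℝ} {ε : ℝ} (hε : 0 < ε) (hα : ∀ k : ℕ, ε ≤ α k)
    (hstep : ∀ k : ℕ, α k * (δ : ℝ) + α (k + 1) * ((δ : ℝ) + β / 2) ≤ 1 - ε)
    {xm x₀ : H} {x : ℕ → H} (hx : IsIterates B D C αm α xm x₀ x) :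
    ∃ xs ∈ zer (opAdd (opAdd B D) C),
      Tendsto (fun k => toWeakSpace ℝ H (x k)) atTop (𝓝 (toWeakSpace ℝ H xs)) := by
  have hα0 : ∀ k, 0 ≤ α k := fun k => hε.le.trans (hα k)
  have hαδ : ∀ k, α k * (δ : ℝ) ≤ 1 - ε := fun k => by
    have h := mul_nonneg (hα0 (k + 1)) (add_nonneg δ.coe_nonneg (div_nonneg hC.nonneg zero_le_two))
    linarith [hstep k]
  set d : ℕ → H := fun k => α k • (D (x (k + 1)) - D (x k)) with hd
  have hdle : ∀ k, ‖d k‖ ≤ ‖x (k + 1) - x k‖ := fun k => by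
    rw [hd, norm_smul, Real.norm_of_nonneg (hα0 k)]
    have h1 := mul_le_mul_of_nonneg_left (hD.norm_sub_le (x (k + 1)) (x k)) (hα0 k)
    have h2 := mul_le_mul_of_nonneg_right (hαδ k) (norm_nonneg (x (k + 1) - x k))
    have h3 := mul_nonneg hε.le (norm_nonneg (x (k + 1) - x k))
    linarith
  -- The index starts at `x 1`, so `αm` and `xm` play no role in the descent.
  set V : H → ℕ → ℝ := fun s k => ‖x (k + 1) - s‖ ^ 2 - 2 * ⟪d k, x (k + 1) - s⟫_ℝ
    + α k * δ * ‖x (k + 1) - x k‖ ^ 2 with hV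
  have hVge : ∀ s k, ε * ‖x (k + 1) - s‖ ^ 2 ≤ V s k := fun s k => by
    have h1 := lyapunov_ge hD (hα0 k) (x k) (x (k + 1)) s
    have h2 := mul_le_mul_of_nonneg_right (hαδ k) (sq_nonneg ‖x (k + 1) - s‖)
    simp only [hV, hd]
    linarith
  have hVstep : ∀ s ∈ zer (opAdd (opAdd B D) C), ∀ k,
      V s (k + 1) ≤ V s k - ε * ‖x (k + 2) - x (k + 1)‖ ^ 2 := fun s hs k => by
    have h1 := lyapunov_step hD hBD.1 hC hs (hα0 k) (hα0 (k + 1)) (hx.step k)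
    have h2 := mul_le_mul_of_nonneg_right (hstep k) (sq_nonneg ‖x (k + 2) - x (k + 1)‖)
    simp only [hV, hd]
    linarith
  have hVlim : ∀ s ∈ zer (opAdd (opAdd B D) C), (∃ c, Tendsto (V s) atTop (𝓝 c)) ∧
      Tendsto (fun k => ε * ‖x (k + 2) - x (k + 1)‖ ^ 2) atTop (𝓝 0) := fun s hs =>
    tendsto_of_le_sub (fun k => (mul_nonneg hε.le (sq_nonneg _)).trans (hVge s k))
      (fun k => mul_nonneg hε.le (sq_nonneg _)) (hVstep s hs)
  obtain ⟨s₀, hs₀⟩ := hzer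
  have hΔ : Tendsto (fun k => ‖x (k + 1) - x k‖) atTop (𝓝 0) := by
    rw [← tendsto_add_atTop_iff_nat 1]
    have h := ((hVlim s₀ hs₀).2.const_mul ε⁻¹).sqrt
    simpa [inv_mul_cancel_left₀ hε.ne'] using h
  have hd0 : Tendsto d atTop (𝓝 0) := squeeze_zero_norm hdle hΔ
  obtain ⟨r, hr⟩ : ∃ r, ∀ k, ‖x k - s₀‖ ≤ r := by
    obtain ⟨c, hc⟩ := (hVlim s₀ hs₀).1.choose_spec.bddAbove_range
    -- `V` controls only `x 1, x 2, …`, so `x 0` enters the bound separately.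
    refine ⟨max ‖x 0 - s₀‖ √(c / ε), fun k => ?_⟩
    cases k with
    | zero => exact le_max_left _ _
    | succ k =>
      refine le_max_of_le_right (Real.le_sqrt_of_sq_le ?_)
      rw [le_div_iff₀' hε]
      exact (hVge s₀ k).trans (hc ⟨k, rfl⟩)
  have hbd : ∀ k, ‖x k‖ ≤ r + ‖s₀‖ := fun k => by
    have h := norm_add_le (x k - s₀) s₀
    rw [sub_add_cancel] at h
    linarith [hr k]
  refine exists_tendsto_toWeakSpace_of_opial hbd (fun s hs => ?_) fun U hU a ha => ?_
  · obtain ⟨c, hc⟩ := (hVlim s hs).1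
    refine ⟨c, ?_⟩
    rw [← tendsto_add_atTop_iff_nat 1]
    have h1 : Tendsto (fun k => ⟪d k, x (k + 1) - s⟫_ℝ) atTop (𝓝 0) := by
      have h : Tendsto (fun k => ‖d k‖ * (r + ‖s₀‖ + ‖s‖)) atTop (𝓝 0) := by
        simpa using hd0.norm.mul_const (r + ‖s₀‖ + ‖s‖)
      refine squeeze_zero_norm (fun k => (norm_inner_le_norm _ _).trans
        (mul_le_mul_of_nonneg_left ?_ (norm_nonneg _))) h
      exact (norm_sub_le _ _).trans (by linarith [hbd (k + 1)])
    have h2 : Tendsto (fun k => α k * δ * ‖x (k + 1) - x k‖ ^ 2) atTop (𝓝 0) := by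
      refine squeeze_zero (fun k => mul_nonneg (mul_nonneg (hα0 k) δ.coe_nonneg) (sq_nonneg _))
        (fun k => mul_le_mul_of_nonneg_right (hαδ k) (sq_nonneg _)) ?_
      simpa using (hΔ.pow 2).const_mul (1 - ε)
    have h := (hc.add (h1.const_mul 2)).sub h2
    simp only [mul_zero, add_zero, sub_zero] at h
    refine h.congr fun k => ?_
    simp only [hV]
    ring
  -- The resolvent inclusion provides an element of `(B + D + C) (x (k + 2))` made of consecutive
  -- differences; `α (k + 1) ≥ ε` keeps the division harmless.
  · have hres : ∀ k, ∃ w ∈ opAdd (opAdd B D) C (x (k + 2)), ‖w‖ ≤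
        ε⁻¹ * (‖x (k + 2) - x (k + 1)‖ + ‖d (k + 1)‖ + ‖d k‖)
          + β * ‖x (k + 2) - x (k + 1)‖ := by
      intro k
      obtain ⟨u, hu, he⟩ := hx.step k
      refine ⟨u + D (x (k + 2)) + C (x (k + 2)), ⟨_, ⟨u, hu, rfl⟩, rfl⟩, ?_⟩
      have hpos : 0 < α (k + 1) := hε.trans_le (hα (k + 1))
      have h1 : u + D (x (k + 2)) + C (x (k + 2)) = (α (k + 1))⁻¹ •
          (-(x (k + 2) - x (k + 1)) + d (k + 1) - d k) + (C (x (k + 2)) - C (x (k + 1))) := by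
        have h2 : α (k + 1) • u = x (k + 1) - α (k + 1) • C (x (k + 1))
            - (α (k + 1) + α k) • D (x (k + 1)) + α k • D (x k) - x (k + 2) :=
          eq_sub_of_add_eq' he.symm
        have h3 : -(x (k + 2) - x (k + 1)) + d (k + 1) - d k
            = α (k + 1) • (u + D (x (k + 2)) + C (x (k + 1))) := by
          simp only [hd, smul_add, h2]
          module
        rw [h3, smul_smul, inv_mul_cancel₀ hpos.ne', one_smul]
        abel
      rw [h1]
      refine (norm_add_le _ _).trans (add_le_add ?_ (hC.norm_sub_le _ _))
      rw [norm_smul, norm_inv, Real.norm_of_nonneg hpos.le]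
      refine mul_le_mul (inv_anti₀ hε (hα (k + 1))) ?_ (norm_nonneg _) (inv_nonneg.2 hε.le)
      refine (norm_sub_le _ _).trans (add_le_add_left ((norm_add_le _ _).trans ?_) _)
      rw [norm_neg]
    choose w hw hwle using hres
    have hΔ1 : Tendsto (fun k => ‖x (k + 2) - x (k + 1)‖) atTop (𝓝 0) :=
      hΔ.comp (tendsto_add_atTop_nat 1)
    have hw0 : Tendsto w atTop (𝓝 0) := by
      refine squeeze_zero_norm hwle ?_
      have h := (((hΔ1.add (hd0.comp (tendsto_add_atTop_nat 1)).norm).add hd0.norm).const_mul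
        ε⁻¹).add (hΔ1.const_mul β)
      simpa using h
    -- The weak limit is known for `x k`, while the residuals sit at `x (k + 2)`.
    have hxd : Tendsto (fun k => x (k + 2) - x k) atTop (𝓝 0) := by
      rw [tendsto_zero_iff_norm_tendsto_zero]
      refine squeeze_zero (fun k => norm_nonneg _) (fun k => ?_) (by simpa using hΔ1.add hΔ)
      rw [← sub_add_sub_cancel (x (k + 2)) (x (k + 1)) (x k)]
      exact norm_add_le _ _
    refine mem_zer_of_tendsto hBD hC hs₀ (fun k => hbd (k + 2)) (fun v => ?_)
      (hw0.mono_left hU) hw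
    have h := (ha v).add ((tendsto_const_nhds (x := v)).inner (hxd.mono_left hU))
    simp only [inner_zero_right, add_zero, ← inner_add_right, add_sub_cancel] at h
    exact h

end Convergence

end FHRB

theorem corollary5p2 {H : Type*} [NormedAddCommGroup H] [InnerProductSpace ℝ H] [CompleteSpace H]
    (B : H → Set H) (D C : H → H) (δ : ℝ≥0) (β : ℝ)
    (hB : FHRB.IsMaximallyMonotone B)
    (hD : LipschitzWith δ D)
    (hBD : FHRB.IsMaximallyMonotone (FHRB.opAdd B D))
    (hC : FHRB.IsInvCocoercive β C)
    (hzer : (FHRB.zer (FHRB.opAdd (FHRB.opAdd B D) C)).Nonempty)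
    (αm : ℝ) (hαm : 0 < αm) (α : ℕ → ℝ) (ε : ℝ) (hε : 0 < ε)
    (hα : ∀ k : ℕ, ε ≤ α k)
    (hstep : ∀ k : ℕ, α k * (δ : ℝ) + α (k + 1) * ((δ : ℝ) + β / 2) ≤ 1 - ε)
    (xm x₀ : H) :
    (∃! x : ℕ → H, FHRB.IsIterates B D C αm α xm x₀ x) ∧
    ∀ x : ℕ → H, FHRB.IsIterates B D C αm α xm x₀ x →
      ∃ xs ∈ FHRB.zer (FHRB.opAdd (FHRB.opAdd B D) C),
        Tendsto (fun k => toWeakSpace ℝ H (x k)) atTop (𝓝 (toWeakSpace ℝ H xs)) :=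
  ⟨FHRB.existsUnique_isIterates hB D C αm (fun k => hε.trans_le (hα k)) xm x₀,
    fun _ hx => FHRB.exists_tendsto_of_isIterates hD hBD hC hzer hε hα hstep hx⟩
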